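/- Let $p$ be an odd prime, let $\mathbb{Z}_p$ be the ring of $p$-adic integers and $\mathbb{Q}_p$ its field of fractions. For $n\ge 0$ let $(x)_n=x(x+1)\cdots(x+n-1)$ denote the shifted factorial (with $(x)_0=1$). Let $\Gamma_p:\mathbb{Z}_p\to\mathbb{Z}_p$ be Morita's $p$-adic Gamma function, defined by $\Gamma_p(0)=1$, $\Gamma_p(n)=(-1)^n\prod_{1\le k<n,\ p\nmid k}k$ for positive integers $n$, and $\Gamma_p(x)=\lim_{n\in\mathbb{N},\ |x-n|_p\to 0}\Gamma_p(n)$ for $x\in\mathbb{Z}_p$. For $a,b\in\mathbb{Q}_p$, write $a\equiv b\pmod{p^k}$ if $a-b\in p^k\mathbb{Z}_p$. If $p\equiv 1\pmod 6$, then $$\frac{(2/3)_{(p-1)/3}^3}{(1)_{(p-1)/3}^3}\left\{1+p^2\sum_{j=1}^{(p-1)/3}\left(\frac{1}{(3j-1)^2}-\frac{1}{(3j)^2}\right)\right\}\equiv -\Gamma_p(1/3)^9\pmod{p^4}.$$ If $p\equiv 5\pmod 6$, then $$\frac{(2/3)_{(2p-1)/3}^3}{(1)_{(2p-1)/3}^3}\equiv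 -\frac{p^3}{27}\,\Gamma_p(1/3)^9\pmod{p^5}.$$ -/

import Mathlib

/-- Morita's `p`-adic Gamma function on the natural numbers:
`Γ_p(0) = 1` and `Γ_p(n) = (-1)^n ∏_{1 ≤ k < n, p ∤ k} k` for `n ≥ 1`
(for `n = 0` the product is empty and the formula gives `1`). -/
def moritaGammaNat (p n : ℕ) : ℤ :=
  (-1) ^ n * ∏ k ∈ (Finset.Ico 1 n).filter (fun k => ¬ p ∣ k), (k : ℤ)

/-- Morita's `p`-adic Gamma function on `ℤ_p`: the limit of `Γ_p(n)` as the natural number `n`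
tends `p`-adically to `x`. (For an odd prime `p` this limit exists for every `x`.) -/
noncomputable def moritaGamma (p : ℕ) [Fact p.Prime] (x : ℤ_[p]) : ℤ_[p] :=
  Filter.limUnder (Filter.comap (fun n : ℕ => (n : ℤ_[p])) (nhds x))
    (fun n : ℕ => (moritaGammaNat p n : ℤ_[p]))

/-- The shifted factorial `(x)_n = x (x + 1) ⋯ (x + n - 1)`. -/
noncomputable def shiftedFactorial {K : Type*} [Field K] (x : K) (n : ℕ) : K :=
  (ascPochhammer K n).eval x

/-- `a ≡ b (mod p^k)` for `p`-adic numbers: `a - b` lies in `p^k ℤ_p`. -/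
def PadicModEq (p : ℕ) [Fact p.Prime] (k : ℕ) (a b : ℚ_[p]) : Prop :=
  ∃ c : ℤ_[p], a - b = (p : ℚ_[p]) ^ k * (c : ℚ_[p])

/-- The `p`-adic integer `1/3`. (`PadicInt.inv` is the genuine inverse on units, so this is meant
for `p ≠ 3`.) -/
noncomputable def oneThird (p : ℕ) [Fact p.Prime] : ℤ_[p] :=
  PadicInt.inv (3 : ℤ_[p])

theorem three_mul_oneThird (p : ℕ) [Fact p.Prime] (hp : p ≠ 3) :
    (3 : ℤ_[p]) * oneThird p = 1 := by
  apply PadicInt.mul_inv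
  have h : ¬ ‖((3 : ℕ) : ℤ_[p])‖ < 1 := by
    rw [PadicInt.norm_natCast_lt_one_iff]
    intro h
    exact hp ((Nat.prime_dvd_prime_iff_eq Fact.out Nat.prime_three).1 h)
  exact le_antisymm (PadicInt.norm_le_one _) (by simpa using h)

/-
Write `t = 1/3` and let `m` be the length of the shifted factorials, so that `m = y - t` with
`p ∣ y`. The functional and reflection equations of `Γ_p` give, once the factors divisible by `p`
are removed, `(2/3)_m / (1)_m = -Γ_p(t)^3 D(t)`, where `D(x) = Γ_p(x + y) Γ_p(x - y) / Γ_p(x)²`.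
This `D` satisfies `D(x + 1) = D(x) (1 - y² / x²)` for units `x` and `D(x) D(1 - x) = 1`, and is
`≡ 1` modulo `p²`, hence `D(x + n) ≡ D(x) - y² ∑ 1 / (x + i)²` modulo `p⁴`. Modulo `p⁴` the
increment of `D` over `p` steps depends only on the residue class of `x` modulo `p`, because `p`
divides `∑ 1 / (x + i)³` over a full period. So `D(t + y) + D(t - y) ≡ 2 D(t)`, and as
`2/3 + m = t + y` and `1 + m = 1 - (t - y)` the two inverse-square sums of length `m` combine with
the reflection equation to `3 (D(t) - 1) ≡ -y² ∑ (1 / (2/3 + i)² - 1 / (1 + i)²)` modulo `p⁴`,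
which is the correction factor of the first case. In the second case one factor `p / 3` of
`(2/3)_m` is not a unit, and `D ≡ 1` modulo `p²` suffices.
-/

open PadicInt
open Finset hiding coe_add coe_mul coe_one coe_pow coe_sub
open scoped Ring

theorem prod_univ_eq_of_sq_eq_one {G : Type*} [CommGroup G] [Fintype G] {a : G} (ha : a ^ 2 = 1)
    (h : ∀ g : G, g ^ 2 = 1 → g = 1 ∨ g = a) : ∏ g : G, g = a := by
  classical
  have hcancel : ∏ g ∈ univ.erase a, g = 1 := by
    refine prod_involution (fun g _ => g⁻¹) (by simp) (fun g hg h1 hinv => ?_) (fun g hg => ?_)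
      (by simp)
    · exact (h g (by rw [sq, ← eq_inv_iff_mul_eq_one, hinv])).elim h1 (ne_of_mem_erase hg)
    · rw [sq, ← eq_inv_iff_mul_eq_one] at ha
      simpa [inv_eq_iff_eq_inv, ← ha] using hg
  rw [← mul_prod_erase univ _ (mem_univ a), hcancel, mul_one]

@[to_additive]
theorem prod_range_add_natCast {M : Type*} [CommMonoid M] (n : ℕ) [NeZero n] (a : ZMod n)
    (g : ZMod n → M) : ∏ i ∈ range n, g (a + i) = ∏ z, g z := by
  refine prod_nbij (fun i : ℕ => a + (i : ZMod n)) (by simp) (fun i hi j hj hij => ?_)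
    (fun z _ => ⟨(z - a).val, by simpa using ZMod.val_lt (z - a), by simp⟩) (by simp)
  have hmod : i ≡ j [MOD n] := (ZMod.natCast_eq_natCast_iff i j n).1 (add_left_cancel hij)
  exact hmod.eq_of_lt_of_lt (by simpa using hi) (by simpa using hj)

/-- The element `x` if it is a unit, and `1` otherwise: the factor `x` contributes to a product
from which the non-units have been removed, as in the definition of `Γ_p`. -/
noncomputable def unitOrOne {M : Type*} [Monoid M] (x : M) : M :=
  open Classical in if IsUnit x then x else 1

theorem unitOrOne_of_isUnit {M : Type*} [Monoid M] {x : M} (hx : IsUnit x) : unitOrOne x = x :=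
  if_pos hx

theorem unitOrOne_of_not_isUnit {M : Type*} [Monoid M] {x : M} (hx : ¬ IsUnit x) :
    unitOrOne x = 1 :=
  if_neg hx

theorem map_unitOrOne {M N F : Type*} [Monoid M] [Monoid N] [FunLike F M N] [MonoidHomClass F M N]
    (f : F) [IsLocalHom f] (x : M) : f (unitOrOne x) = unitOrOne (f x) := by
  by_cases hx : IsUnit x
  · rw [unitOrOne_of_isUnit hx, unitOrOne_of_isUnit (hx.map f)]
  · rw [unitOrOne_of_not_isUnit hx, unitOrOne_of_not_isUnit (by rwa [isUnit_map_iff]), map_one]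

theorem prod_eq_mul_prod_unitOrOne {ι M : Type*} [CommMonoid M] {s : Finset ι} {f : ι → M} {j : ι}
    (hj : j ∈ s) (hfj : ¬ IsUnit (f j)) (hf : ∀ i ∈ s, i ≠ j → IsUnit (f i)) :
    ∏ i ∈ s, f i = f j * ∏ i ∈ s, unitOrOne (f i) := by
  classical
  rw [← mul_prod_erase s f hj, ← mul_prod_erase s _ hj, unitOrOne_of_not_isUnit hfj, one_mul]
  refine congrArg _ (prod_congr rfl fun i hi => (unitOrOne_of_isUnit ?_).symm)
  exact hf i (mem_of_mem_erase hi) (ne_of_mem_erase hi)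

theorem unitOrOne_neg_sq {R : Type*} [Ring R] (x : R) : unitOrOne (-x) ^ 2 = unitOrOne x ^ 2 := by
  by_cases hx : IsUnit x
  · rw [unitOrOne_of_isUnit hx, unitOrOne_of_isUnit hx.neg, neg_sq]
  · rw [unitOrOne_of_not_isUnit hx, unitOrOne_of_not_isUnit (by rwa [IsUnit.neg_iff])]

theorem unitOrOne_add_mul_unitOrOne_sub {R : Type*} [CommRing R] {x y : R}
    (hadd : IsUnit (x + y) ↔ IsUnit x) (hsub : IsUnit (x - y) ↔ IsUnit x) :
    unitOrOne (x + y) * unitOrOne (x - y) = unitOrOne x ^ 2 * (1 - y ^ 2 * x⁻¹ʳ ^ 2) := by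
  by_cases hx : IsUnit x
  · rw [unitOrOne_of_isUnit hx, unitOrOne_of_isUnit (hadd.2 hx), unitOrOne_of_isUnit (hsub.2 hx)]
    linear_combination y ^ 2 * (1 + x * x⁻¹ʳ) * Ring.mul_inverse_cancel x hx
  · rw [unitOrOne_of_not_isUnit hx, unitOrOne_of_not_isUnit (mt hadd.1 hx),
      unitOrOne_of_not_isUnit (mt hsub.1 hx), Ring.inverse_non_unit x hx]
    ring

section LocalRing

variable {R : Type*} [CommRing R] [IsLocalRing R]

theorem eq_one_or_eq_neg_one_of_sq_eq_one (h2 : IsUnit (2 : R)) {x : R} (hx : x ^ 2 = 1) :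
    x = 1 ∨ x = -1 := by
  have hfactor : (x + 1) * (1 - x) = 0 := by linear_combination -hx
  have hsum : IsUnit ((x + 1) + (1 - x)) := by convert h2 using 1; ring
  rcases IsLocalRing.isUnit_or_isUnit_of_isUnit_add hsum with hunit | hunit
  · exact .inl (sub_eq_zero.1 (hunit.mul_right_eq_zero.1 hfactor)).symm
  · exact .inr (eq_neg_of_add_eq_zero_left (hunit.mul_left_eq_zero.1 hfactor))

theorem prod_unitOrOne_eq_neg_one [Fintype R] (h2 : IsUnit (2 : R)) :
    ∏ x : R, unitOrOne x = -1 := by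
  classical
  have hunits : ∏ u : Rˣ, u = -1 := prod_univ_eq_of_sq_eq_one neg_one_sq fun u hu =>
    (eq_one_or_eq_neg_one_of_sq_eq_one h2 (congrArg Units.val hu)).imp Units.ext Units.ext
  have hprod := congrArg Units.val hunits
  rw [Units.coe_prod, Units.val_neg, Units.val_one] at hprod
  rw [← hprod]
  refine (Fintype.prod_of_injective Units.val Units.val_injective _ _ (fun x hx => ?_)
    fun u => (unitOrOne_of_isUnit u.isUnit).symm).symm
  exact unitOrOne_of_not_isUnit hx

end LocalRing

theorem sq_dvd_inverse_add_sq_sub {R : Type*} [CommRing R] {x y : R}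
    (h : IsUnit (x + y) ↔ IsUnit x) :
    y ^ 2 ∣ (x + y)⁻¹ʳ ^ 2 - (x⁻¹ʳ ^ 2 - 2 * y * x⁻¹ʳ ^ 3) := by
  have hw : (x + y)⁻¹ʳ - x⁻¹ʳ = (x + y)⁻¹ʳ * (x - (x + y)) * x⁻¹ʳ := Ring.inverse_sub_inverse h
  refine ⟨2 * x⁻¹ʳ ^ 3 * (x + y)⁻¹ʳ + x⁻¹ʳ ^ 2 * (x + y)⁻¹ʳ ^ 2, ?_⟩
  linear_combination ((x + y)⁻¹ʳ + x⁻¹ʳ - y * x⁻¹ʳ * (x + y)⁻¹ʳ - 2 * y * x⁻¹ʳ ^ 2) * hw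

theorem map_ringInverse {R S : Type*} [Semiring R] [Semiring S] (f : R →+* S) [IsLocalHom f]
    (x : R) : f x⁻¹ʳ = (f x)⁻¹ʳ := by
  by_cases hx : IsUnit x
  · apply (hx.map f).mul_left_cancel
    rw [← map_mul, Ring.mul_inverse_cancel x hx, map_one, Ring.mul_inverse_cancel _ (hx.map f)]
  · rw [Ring.inverse_non_unit x hx, Ring.inverse_non_unit _ (by rwa [isUnit_map_iff]), map_zero]

section Reduction

variable {p : ℕ} [Fact p.Prime]

theorem isUnit_iff_not_prime_dvd {x : ℤ_[p]} : IsUnit x ↔ ¬ (p : ℤ_[p]) ∣ x := by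
  rw [← norm_lt_one_iff_dvd, ← mem_nonunits, mem_nonunits_iff, not_not]

theorem isUnit_natCast_iff {n : ℕ} : IsUnit (n : ℤ_[p]) ↔ ¬ p ∣ n := by
  rw [isUnit_iff_not_prime_dvd, ← norm_lt_one_iff_dvd, norm_natCast_lt_one_iff]

theorem isUnit_two (h2 : p ≠ 2) : IsUnit (2 : ℤ_[p]) := by
  refine (isUnit_natCast_iff (n := 2)).2 fun h => ?_
  exact h2 ((Nat.prime_dvd_prime_iff_eq Fact.out Nat.prime_two).1 h)

theorem isUnit_add_iff_of_prime_dvd {x y : ℤ_[p]} (hy : (p : ℤ_[p]) ∣ y) :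
    IsUnit (x + y) ↔ IsUnit x := by
  rw [isUnit_iff_not_prime_dvd, isUnit_iff_not_prime_dvd, dvd_add_left hy]

theorem isUnit_sub_iff_of_prime_dvd {x y : ℤ_[p]} (hy : (p : ℤ_[p]) ∣ y) :
    IsUnit (x - y) ↔ IsUnit x := by
  rw [isUnit_iff_not_prime_dvd, isUnit_iff_not_prime_dvd, dvd_sub_left hy]

theorem toZModPow_eq_iff_dvd {k : ℕ} {x y : ℤ_[p]} :
    toZModPow k x = toZModPow k y ↔ (p : ℤ_[p]) ^ k ∣ x - y := by
  rw [← Ideal.mem_span_singleton, ← ker_toZModPow, RingHom.mem_ker, map_sub, sub_eq_zero]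

theorem eq_of_forall_toZModPow_succ_eq {x y : ℤ_[p]}
    (h : ∀ k, toZModPow (k + 1) x = toZModPow (k + 1) y) : x = y := by
  refine ext_of_toZModPow.1 fun k => toZModPow_eq_iff_dvd.2 ?_
  exact (pow_dvd_pow _ k.le_succ).trans (toZModPow_eq_iff_dvd.1 (h k))

theorem exists_nat_toZModPow_eq (k : ℕ) (x : ℤ_[p]) :
    ∃ n : ℕ, toZModPow k (n : ℤ_[p]) = toZModPow k x :=
  ⟨x.appr k, (toZModPow_eq_iff_dvd.2 (Ideal.mem_span_singleton.1 (appr_spec k x))).symm⟩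

theorem eventually_toZModPow_eq (k : ℕ) (x : ℤ_[p]) :
    ∀ᶠ z in nhds x, toZModPow k z = toZModPow k x := by
  have hp : (0 : ℝ) < p := by exact_mod_cast (Fact.out : p.Prime).pos
  filter_upwards [Metric.closedBall_mem_nhds x (zpow_pos hp (-k : ℤ))] with z hz
  rwa [Metric.mem_closedBall, dist_eq_norm, norm_le_pow_iff_mem_span_pow,
    Ideal.mem_span_singleton, ← toZModPow_eq_iff_dvd] at hz

instance isLocalRing_zmod_prime_pow_succ (k : ℕ) : IsLocalRing (ZMod (p ^ (k + 1))) :=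
  have : Fact (1 < p ^ (k + 1)) := ⟨Nat.one_lt_pow k.succ_ne_zero (Fact.out : p.Prime).one_lt⟩
  .of_surjective' (toZModPow (k + 1)) (ZMod.ringHom_surjective _)

instance isLocalHom_toZModPow_succ (k : ℕ) : IsLocalHom (toZModPow (p := p) (k + 1)) :=
  .of_surjective _ (ZMod.ringHom_surjective _)

instance isLocalHom_toZMod : IsLocalHom (toZMod (p := p)) :=
  .of_surjective _ (ZMod.ringHom_surjective _)

theorem prime_dvd_sum_inverse_pow {j : ℕ} (hj : j < p - 1) (x : ℤ_[p]) :
    (p : ℤ_[p]) ∣ ∑ i ∈ range p, (x + i)⁻¹ʳ ^ j := by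
  rw [← Ideal.mem_span_singleton, ← maximalIdeal_eq_span_p, ← ker_toZMod, RingHom.mem_ker, map_sum]
  simp only [map_pow, map_ringInverse, map_add, map_natCast, Ring.inverse_eq_inv]
  rw [sum_range_add_natCast p (toZMod x) fun z => z⁻¹ ^ j,
    Fintype.sum_equiv (Equiv.inv (ZMod p)) (fun z => z⁻¹ ^ j) (fun z => z ^ j) fun _ => rfl]
  exact FiniteField.sum_pow_lt_card_sub_one (ZMod p) j (by rwa [ZMod.card])

end Reduction

section moritaGamma

variable {p : ℕ} [Fact p.Prime]

theorem cast_moritaGammaNat (n : ℕ) :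
    (moritaGammaNat p n : ℤ_[p]) = ∏ i ∈ range n, -unitOrOne (i : ℤ_[p]) := by
  have hfactor (i : ℕ) : (if ¬ p ∣ i then (i : ℤ_[p]) else 1) = unitOrOne (i : ℤ_[p]) := by
    split_ifs with hi
    · rw [unitOrOne_of_not_isUnit (by rwa [isUnit_natCast_iff, not_not])]
    · rw [unitOrOne_of_isUnit (isUnit_natCast_iff.2 hi)]
  rw [moritaGammaNat, prod_neg, card_range]
  push_cast
  rw [prod_filter]
  simp only [hfactor]
  rcases n.eq_zero_or_pos with rfl | hn
  · simp
  · rw [range_eq_Ico, prod_eq_prod_Ico_succ_bot hn, Nat.cast_zero,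
      unitOrOne_of_not_isUnit not_isUnit_zero, one_mul]

theorem toZModPow_moritaGammaNat_add_prime_pow (h2 : p ≠ 2) (k n : ℕ) :
    toZModPow (k + 1) (moritaGammaNat p (n + p ^ (k + 1)) : ℤ_[p]) =
      toZModPow (k + 1) (moritaGammaNat p n : ℤ_[p]) := by
  have hodd : Odd (p ^ (k + 1)) := ((Fact.out : p.Prime).odd_of_ne_two h2).pow
  have htwo : IsUnit (2 : ZMod (p ^ (k + 1))) := by
    have h := (isUnit_two h2).map (toZModPow (k + 1))
    rwa [map_ofNat] at h
  have hwindow : toZModPow (k + 1) (∏ i ∈ range (p ^ (k + 1)), -unitOrOne ((n + i : ℕ) : ℤ_[p])) =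
      1 := by
    simp only [map_prod, map_neg, map_unitOrOne, Nat.cast_add, map_add, map_natCast]
    rw [prod_range_add_natCast _ (n : ZMod (p ^ (k + 1))) fun z => -unitOrOne z, prod_neg,
      prod_unitOrOne_eq_neg_one htwo, card_univ, ZMod.card, hodd.neg_one_pow, neg_one_mul, neg_neg]
  rw [cast_moritaGammaNat, cast_moritaGammaNat, prod_range_add, map_mul, hwindow, mul_one]

theorem toZModPow_moritaGammaNat_congr (h2 : p ≠ 2) {k m n : ℕ}
    (h : toZModPow k (m : ℤ_[p]) = toZModPow k (n : ℤ_[p])) :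
    toZModPow k (moritaGammaNat p m : ℤ_[p]) = toZModPow k (moritaGammaNat p n : ℤ_[p]) := by
  rw [map_natCast, map_natCast, ZMod.natCast_eq_natCast_iff'] at h
  cases k with
  | zero => exact toZModPow_eq_iff_dvd.2 (by simp)
  | succ k =>
    have hper : Function.Periodic (fun n => toZModPow (k + 1) (moritaGammaNat p n : ℤ_[p]))
        (p ^ (k + 1)) := toZModPow_moritaGammaNat_add_prime_pow h2 k
    exact (hper.map_mod_nat m).symm.trans (h ▸ hper.map_mod_nat n)

theorem comap_natCast_nhds_neBot (x : ℤ_[p]) :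
    (Filter.comap (fun n : ℕ => (n : ℤ_[p])) (nhds x)).NeBot :=
  Filter.comap_neBot_iff_frequently.2
    ((mem_closure_iff_frequently.1 (denseRange_natCast x)).mono (by simp))

theorem tendsto_moritaGammaNat (h2 : p ≠ 2) (x : ℤ_[p]) :
    Filter.Tendsto (fun n : ℕ => (moritaGammaNat p n : ℤ_[p]))
      (Filter.comap (fun n : ℕ => (n : ℤ_[p])) (nhds x)) (nhds (moritaGamma p x)) := by
  have := comap_natCast_nhds_neBot x
  refine tendsto_nhds_limUnder (cauchy_map_iff_exists_tendsto.1 (Metric.cauchy_iff.2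
    ⟨inferInstance, fun ε hε => ?_⟩))
  obtain ⟨k, hk⟩ := exists_pow_neg_lt p hε
  refine ⟨_, Filter.image_mem_map (Filter.tendsto_comap.eventually (eventually_toZModPow_eq k x)),
    ?_⟩
  rintro _ ⟨m, hm, rfl⟩ _ ⟨n, hn, rfl⟩
  refine lt_of_le_of_lt ?_ hk
  rw [dist_eq_norm, norm_le_pow_iff_mem_span_pow, Ideal.mem_span_singleton, ← toZModPow_eq_iff_dvd]
  exact toZModPow_moritaGammaNat_congr h2 (hm.trans hn.symm)

theorem toZModPow_moritaGamma (h2 : p ≠ 2) {x : ℤ_[p]} {k n : ℕ}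
    (h : toZModPow k (n : ℤ_[p]) = toZModPow k x) :
    toZModPow k (moritaGamma p x) = toZModPow k (moritaGammaNat p n : ℤ_[p]) := by
  have := comap_natCast_nhds_neBot x
  obtain ⟨m, hlim, hx⟩ :=
    (((tendsto_moritaGammaNat h2 x).eventually (eventually_toZModPow_eq k _)).and
      (Filter.tendsto_comap.eventually (eventually_toZModPow_eq k x))).exists
  exact hlim.symm.trans (toZModPow_moritaGammaNat_congr h2 (hx.trans h.symm))

theorem toZModPow_moritaGamma_congr (h2 : p ≠ 2) {x y : ℤ_[p]} {k : ℕ}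
    (h : toZModPow k x = toZModPow k y) :
    toZModPow k (moritaGamma p x) = toZModPow k (moritaGamma p y) := by
  obtain ⟨n, hn⟩ := exists_nat_toZModPow_eq k y
  rw [toZModPow_moritaGamma h2 hn, toZModPow_moritaGamma h2 (hn.trans h.symm)]

theorem moritaGamma_zero (h2 : p ≠ 2) : moritaGamma p 0 = 1 :=
  ext_of_toZModPow.1 fun k => by
    rw [toZModPow_moritaGamma (n := 0) h2 (by simp), cast_moritaGammaNat, prod_range_zero]

theorem moritaGamma_add_one (h2 : p ≠ 2) (x : ℤ_[p]) :
    moritaGamma p (x + 1) = -unitOrOne x * moritaGamma p x := by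
  refine eq_of_forall_toZModPow_succ_eq fun k => ?_
  obtain ⟨n, hn⟩ := exists_nat_toZModPow_eq (k + 1) x
  rw [toZModPow_moritaGamma (n := n + 1) h2 (by rw [Nat.cast_succ, map_add, hn, map_add]),
    cast_moritaGammaNat, prod_range_succ_comm, ← cast_moritaGammaNat, map_mul, map_mul, map_neg,
    map_neg, map_unitOrOne, map_unitOrOne, hn, toZModPow_moritaGamma h2 hn]

theorem moritaGamma_one (h2 : p ≠ 2) : moritaGamma p 1 = -1 := by
  simpa [moritaGamma_zero h2, unitOrOne_of_not_isUnit] using moritaGamma_add_one (p := p) h2 0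

theorem moritaGamma_add_natCast (h2 : p ≠ 2) (x : ℤ_[p]) (n : ℕ) :
    moritaGamma p (x + n) =
      (-1) ^ n * (∏ i ∈ range n, unitOrOne (x + i)) * moritaGamma p x := by
  induction n with
  | zero => simp
  | succ n ih =>
    rw [Nat.cast_succ, ← add_assoc, moritaGamma_add_one h2, ih, prod_range_succ]
    ring

theorem moritaGamma_reflection_sq (h2 : p ≠ 2) (x : ℤ_[p]) :
    (moritaGamma p x * moritaGamma p (1 - x)) ^ 2 = 1 := by
  have hnat (n : ℕ) : (moritaGamma p n * moritaGamma p (1 - n)) ^ 2 = 1 := by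
    induction n with
    | zero => simp [moritaGamma_zero h2, moritaGamma_one h2]
    | succ n ih =>
      have hreflect := moritaGamma_add_one h2 (-n : ℤ_[p])
      rw [neg_add_eq_sub] at hreflect
      rw [hreflect] at ih
      rw [Nat.cast_succ, moritaGamma_add_one h2, sub_add_cancel_right]
      linear_combination ih - (moritaGamma p n * moritaGamma p (-n)) ^ 2 *
        unitOrOne_neg_sq (n : ℤ_[p])
  refine ext_of_toZModPow.1 fun k => ?_
  obtain ⟨n, hn⟩ := exists_nat_toZModPow_eq k x
  have hn' : toZModPow k (1 - n : ℤ_[p]) = toZModPow k (1 - x) := by rw [map_sub, hn, map_sub]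
  rw [map_pow, map_mul, ← toZModPow_moritaGamma_congr h2 hn, ← toZModPow_moritaGamma_congr h2 hn',
    ← map_mul, ← map_pow, hnat]

theorem moritaGamma_reflection_congr (h2 : p ≠ 2) {x y : ℤ_[p]} (h : (p : ℤ_[p]) ∣ x - y) :
    moritaGamma p x * moritaGamma p (1 - x) = moritaGamma p y * moritaGamma p (1 - y) := by
  have hxy : toZModPow 1 x = toZModPow 1 y := toZModPow_eq_iff_dvd.2 (by rwa [pow_one])
  have hxy' : toZModPow 1 (1 - x) = toZModPow 1 (1 - y) := by rw [map_sub, hxy, map_sub]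
  have hmod : (p : ℤ_[p]) ∣ moritaGamma p x * moritaGamma p (1 - x) -
      moritaGamma p y * moritaGamma p (1 - y) := by
    rw [← pow_one (p : ℤ_[p]), ← toZModPow_eq_iff_dvd, map_mul, map_mul,
      toZModPow_moritaGamma_congr h2 hxy, toZModPow_moritaGamma_congr h2 hxy']
  have hy := moritaGamma_reflection_sq h2 y
  rcases sq_eq_sq_iff_eq_or_eq_neg.1 ((moritaGamma_reflection_sq h2 x).trans hy.symm)
    with heq | hneg
  · exact heq
  · rw [hneg, ← neg_add', ← two_mul, dvd_neg] at hmod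
    refine absurd hmod (isUnit_iff_not_prime_dvd.1 ((isUnit_two h2).mul ?_))
    exact IsUnit.of_mul_eq_one _ ((sq _).symm.trans hy)

theorem prod_unitOrOne_one_sub_add (h2 : p ≠ 2) {x : ℤ_[p]} {m : ℕ} (h : (p : ℤ_[p]) ∣ x + m) :
    ∏ i ∈ range m, unitOrOne (1 - x + i) =
      -(moritaGamma p x * moritaGamma p (-m) * moritaGamma p (1 - x + m)) *
        ∏ i ∈ range m, unitOrOne (1 + i : ℤ_[p]) := by
  have hnum := moritaGamma_add_natCast h2 (1 - x) m
  have hden := moritaGamma_add_natCast (p := p) h2 1 m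
  rw [moritaGamma_one h2] at hden
  have hsq := moritaGamma_reflection_sq h2 x
  have hcongr := moritaGamma_reflection_congr h2 (x := x) (y := -m) (by rwa [sub_neg_eq_add])
  rw [sub_neg_eq_add, hden] at hcongr
  rw [hnum]
  linear_combination (-∏ i ∈ range m, unitOrOne (1 - x + i)) * hsq +
    (∏ i ∈ range m, unitOrOne (1 - x + i)) * moritaGamma p x * moritaGamma p (1 - x) * hcongr

/-- The multiplicative second difference `Γ_p(x + y) Γ_p(x - y) / Γ_p(x)²` of `Γ_p`. By the
reflection formula `Γ_p(x)⁻²` equals `Γ_p(1 - x)²`, which avoids a division. -/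
noncomputable def gammaRatio (y x : ℤ_[p]) : ℤ_[p] :=
  moritaGamma p (x + y) * moritaGamma p (x - y) * moritaGamma p (1 - x) ^ 2

theorem gammaRatio_mul_sq (h2 : p ≠ 2) (y x : ℤ_[p]) :
    gammaRatio y x * moritaGamma p x ^ 2 = moritaGamma p (x + y) * moritaGamma p (x - y) := by
  rw [gammaRatio]
  linear_combination
    moritaGamma p (x + y) * moritaGamma p (x - y) * moritaGamma_reflection_sq h2 x

theorem toZModPow_gammaRatio_congr (h2 : p ≠ 2) (y : ℤ_[p]) {x x' : ℤ_[p]} {k : ℕ}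
    (h : toZModPow k x = toZModPow k x') :
    toZModPow k (gammaRatio y x) = toZModPow k (gammaRatio y x') := by
  have hadd : toZModPow k (x + y) = toZModPow k (x' + y) := by rw [map_add, h, map_add]
  have hsub : toZModPow k (x - y) = toZModPow k (x' - y) := by rw [map_sub, h, map_sub]
  have hreflect : toZModPow k (1 - x) = toZModPow k (1 - x') := by rw [map_sub, h, map_sub]
  simp only [gammaRatio, map_mul, map_pow, toZModPow_moritaGamma_congr h2 hadd,
    toZModPow_moritaGamma_congr h2 hsub, toZModPow_moritaGamma_congr h2 hreflect]

end moritaGamma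

section gammaRatio

variable {p : ℕ} [Fact p.Prime] {y : ℤ_[p]}

theorem gammaRatio_zero (h2 : p ≠ 2) (hy : (p : ℤ_[p]) ∣ y) : gammaRatio y 0 = 1 := by
  have hreflect := moritaGamma_reflection_congr h2 (x := y) (y := 0) (by rwa [sub_zero])
  have hadd := moritaGamma_add_one h2 (-y)
  rw [unitOrOne_of_not_isUnit (by rwa [isUnit_iff_not_prime_dvd, not_not, dvd_neg]),
    neg_add_eq_sub] at hadd
  rw [hadd, sub_zero, moritaGamma_zero h2, moritaGamma_one h2] at hreflect
  rw [gammaRatio, zero_add, zero_sub, sub_zero, moritaGamma_one h2]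
  linear_combination -hreflect

theorem gammaRatio_add_one (h2 : p ≠ 2) (hy : (p : ℤ_[p]) ∣ y) (x : ℤ_[p]) :
    gammaRatio y (x + 1) = gammaRatio y x * (1 - y ^ 2 * x⁻¹ʳ ^ 2) := by
  have hreflect := moritaGamma_add_one h2 (-x)
  rw [neg_add_eq_sub] at hreflect
  rw [gammaRatio, gammaRatio, add_right_comm, add_sub_right_comm, sub_add_cancel_right,
    moritaGamma_add_one h2, moritaGamma_add_one h2, hreflect]
  have hunits := unitOrOne_add_mul_unitOrOne_sub (isUnit_add_iff_of_prime_dvd (x := x) hy)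
    (isUnit_sub_iff_of_prime_dvd hy)
  linear_combination moritaGamma p (x + y) * moritaGamma p (x - y) * moritaGamma p (-x) ^ 2 *
    (hunits - (1 - y ^ 2 * x⁻¹ʳ ^ 2) * unitOrOne_neg_sq x)

theorem gammaRatio_reflection (h2 : p ≠ 2) (hy : (p : ℤ_[p]) ∣ y) (x : ℤ_[p]) :
    gammaRatio y x * gammaRatio y (1 - x) = 1 := by
  have hadd := moritaGamma_reflection_congr h2 (x := x + y) (y := x) (by rwa [add_sub_cancel_left])
  have hsub := moritaGamma_reflection_congr h2 (x := x - y) (y := x)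
    (by rwa [sub_sub_cancel_left, dvd_neg])
  have hsq := moritaGamma_reflection_sq h2 x
  rw [gammaRatio, gammaRatio, sub_sub_cancel, sub_add 1 x y, sub_sub 1 x y]
  calc _ = (moritaGamma p (x + y) * moritaGamma p (1 - (x + y))) *
        (moritaGamma p (x - y) * moritaGamma p (1 - (x - y))) *
        (moritaGamma p x * moritaGamma p (1 - x)) ^ 2 := by ring_nf
    _ = 1 := by rw [hadd, hsub, ← sq, hsq, one_mul]

theorem prime_sq_dvd_gammaRatio_sub_one (h2 : p ≠ 2) (hy : (p : ℤ_[p]) ∣ y) (x : ℤ_[p]) :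
    (p : ℤ_[p]) ^ 2 ∣ gammaRatio y x - 1 := by
  obtain ⟨n, hn⟩ := exists_nat_toZModPow_eq 2 x
  rw [← toZModPow_eq_iff_dvd, ← toZModPow_gammaRatio_congr h2 y hn, toZModPow_eq_iff_dvd]
  clear hn
  induction n with
  | zero => simp [gammaRatio_zero h2 hy]
  | succ n ih =>
    rw [Nat.cast_succ, gammaRatio_add_one h2 hy, mul_one_sub, sub_right_comm]
    exact dvd_sub ih (((pow_dvd_pow_of_dvd hy 2).mul_right _).mul_left _)

theorem prime_pow_four_dvd_gammaRatio_reflection (h2 : p ≠ 2) (hy : (p : ℤ_[p]) ∣ y) (x : ℤ_[p]) :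
    (p : ℤ_[p]) ^ 4 ∣ gammaRatio y x + gammaRatio y (1 - x) - 2 := by
  have hdvd := mul_dvd_mul (prime_sq_dvd_gammaRatio_sub_one h2 hy x)
    (prime_sq_dvd_gammaRatio_sub_one h2 hy (1 - x))
  rw [← pow_add, ← dvd_neg] at hdvd
  convert hdvd using 1
  linear_combination gammaRatio_reflection h2 hy x

/-- The sum of the inverse squares of the units among `x, x + 1, …, x + n - 1`; the terms of the
non-units vanish, as `Ring.inverse` is zero there. -/
noncomputable def sumInvSq (n : ℕ) (x : ℤ_[p]) : ℤ_[p] :=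
  ∑ i ∈ range n, (x + i)⁻¹ʳ ^ 2

theorem prime_sq_dvd_sumInvSq_add_sub (hp : 5 ≤ p) (hy : (p : ℤ_[p]) ∣ y) (x : ℤ_[p]) :
    (p : ℤ_[p]) ^ 2 ∣ sumInvSq p (x + y) - sumInvSq p x := by
  have hterm (i : ℕ) : (p : ℤ_[p]) ^ 2 ∣
      (x + y + i)⁻¹ʳ ^ 2 - ((x + i)⁻¹ʳ ^ 2 - 2 * y * (x + i)⁻¹ʳ ^ 3) := by
    rw [add_right_comm]
    exact (pow_dvd_pow_of_dvd hy 2).trans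
      (sq_dvd_inverse_add_sq_sub (isUnit_add_iff_of_prime_dvd hy))
  have hcubes : (p : ℤ_[p]) ^ 2 ∣ 2 * y * ∑ i ∈ range p, (x + i)⁻¹ʳ ^ 3 := by
    rw [sq]
    exact mul_dvd_mul (hy.mul_left 2) (prime_dvd_sum_inverse_pow (by lia) x)
  have hsum := dvd_sum fun i (_ : i ∈ range p) => hterm i
  rw [sum_sub_distrib, sum_sub_distrib, ← mul_sum, ← sub_add] at hsum
  exact (dvd_add_left hcubes).1 hsum

theorem prime_pow_four_dvd_gammaRatio_add_natCast (h2 : p ≠ 2) (hy : (p : ℤ_[p]) ∣ y) (x : ℤ_[p])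
    (n : ℕ) : (p : ℤ_[p]) ^ 4 ∣ gammaRatio y (x + n) - (gammaRatio y x - y ^ 2 * sumInvSq n x) := by
  induction n with
  | zero => simp [sumInvSq]
  | succ n ih =>
    have hquad := mul_dvd_mul (pow_dvd_pow_of_dvd hy 2)
      (prime_sq_dvd_gammaRatio_sub_one h2 hy (x + n))
    rw [← pow_add] at hquad
    have hsucc : sumInvSq (n + 1) x = sumInvSq n x + (x + n)⁻¹ʳ ^ 2 := sum_range_succ _ _
    convert dvd_sub ih (hquad.mul_right ((x + n)⁻¹ʳ ^ 2)) using 1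
    rw [Nat.cast_succ, ← add_assoc, gammaRatio_add_one h2 hy, hsucc]
    ring

theorem prime_pow_four_dvd_gammaRatio_add_prime_mul (hp : 5 ≤ p) (hy : (p : ℤ_[p]) ∣ y)
    (x z : ℤ_[p]) : (p : ℤ_[p]) ^ 4 ∣
      gammaRatio y (x + p * z) - (gammaRatio y x - z * y ^ 2 * sumInvSq p x) := by
  have h2 : p ≠ 2 := by lia
  obtain ⟨n, hn⟩ := exists_nat_toZModPow_eq 4 z
  have hxn : toZModPow 4 (x + p * n : ℤ_[p]) = toZModPow 4 (x + p * z : ℤ_[p]) := by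
    rw [map_add, map_mul, hn, map_add, map_mul]
  rw [← toZModPow_eq_iff_dvd, ← toZModPow_gammaRatio_congr h2 y hxn, map_sub, mul_assoc,
    map_mul _ z, ← hn, ← map_mul, ← map_sub, toZModPow_eq_iff_dvd]
  clear hn hxn
  induction n with
  | zero => simp
  | succ n ih =>
    have hstep := prime_pow_four_dvd_gammaRatio_add_natCast h2 hy (x + p * n) p
    have hperiod := mul_dvd_mul (pow_dvd_pow_of_dvd hy 2)
      (prime_sq_dvd_sumInvSq_add_sub hp (dvd_mul_right (p : ℤ_[p]) n) x)
    rw [← pow_add] at hperiod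
    convert dvd_add ih (dvd_sub hstep hperiod) using 1
    rw [Nat.cast_succ, mul_add_one, ← add_assoc]
    ring

theorem prime_pow_four_dvd_gammaRatio_add_sub (hp : 5 ≤ p) (hy : (p : ℤ_[p]) ∣ y) {z : ℤ_[p]}
    (hz : (p : ℤ_[p]) ∣ z) (x : ℤ_[p]) :
    (p : ℤ_[p]) ^ 4 ∣ gammaRatio y (x + z) + gammaRatio y (x - z) - 2 * gammaRatio y x := by
  obtain ⟨w, rfl⟩ := hz
  have hsub := prime_pow_four_dvd_gammaRatio_add_prime_mul hp hy x (-w)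
  rw [mul_neg, ← sub_eq_add_neg] at hsub
  convert dvd_add (prime_pow_four_dvd_gammaRatio_add_prime_mul hp hy x w) hsub using 1
  ring

end gammaRatio

section OneThird

variable {p : ℕ} [Fact p.Prime] {t y : ℤ_[p]} {m : ℕ}

theorem prime_pow_four_dvd_three_mul_gammaRatio_sub_one (hp : 5 ≤ p) (ht : 3 * t = 1)
    (hy : (p : ℤ_[p]) ∣ y) (hm : (m : ℤ_[p]) = y - t) : (p : ℤ_[p]) ^ 4 ∣
      3 * (gammaRatio y t - 1) + y ^ 2 * (sumInvSq m (2 * t) - sumInvSq m 1) := by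
  have h2 : p ≠ 2 := by lia
  have htwo : 2 * t = 1 - t := by linear_combination ht
  have hadd := prime_pow_four_dvd_gammaRatio_add_natCast h2 hy (2 * t) m
  rw [show 2 * t + m = t + y by rw [hm]; ring, htwo] at hadd
  have hsub := prime_pow_four_dvd_gammaRatio_add_natCast h2 hy 1 m
  rw [show 1 + (m : ℤ_[p]) = 1 - (t - y) by rw [hm]; ring] at hsub
  have hone := gammaRatio_reflection h2 hy 0
  rw [gammaRatio_zero h2 hy, one_mul, sub_zero] at hone
  have hdiff := prime_pow_four_dvd_gammaRatio_add_sub hp hy hy t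
  have hreflect := prime_pow_four_dvd_gammaRatio_reflection h2 hy t
  have hreflect' := prime_pow_four_dvd_gammaRatio_reflection h2 hy (t - y)
  convert dvd_add (dvd_sub (dvd_add (dvd_sub hadd hdiff) hreflect') hsub) hreflect using 1
  rw [htwo, hone]
  ring

theorem prime_pow_four_dvd_gammaRatio_pow_three_mul_sub_one (hp : 5 ≤ p) (ht : 3 * t = 1)
    (hy : (p : ℤ_[p]) ∣ y) (hm : (m : ℤ_[p]) = y - t) : (p : ℤ_[p]) ^ 4 ∣
      gammaRatio y t ^ 3 * (1 + y ^ 2 * (sumInvSq m (2 * t) - sumInvSq m 1)) - 1 := by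
  have hlin := prime_pow_four_dvd_three_mul_gammaRatio_sub_one hp ht hy hm
  have hD := prime_sq_dvd_gammaRatio_sub_one (by lia) hy t
  have hsq := mul_dvd_mul hD hD
  rw [← pow_add] at hsq
  convert dvd_sub (hlin.mul_left (gammaRatio y t ^ 3)) (hsq.mul_left
    (3 * gammaRatio y t ^ 2 + 2 * gammaRatio y t + 1)) using 1
  ring

theorem prod_unitOrOne_two_mul_add (h2 : p ≠ 2) (ht : 3 * t = 1) (hy : (p : ℤ_[p]) ∣ y)
    (hm : (m : ℤ_[p]) = y - t) : ∏ i ∈ range m, unitOrOne (2 * t + i) =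
      -(moritaGamma p t ^ 3 * gammaRatio y t) * ∏ i ∈ range m, unitOrOne (1 + i : ℤ_[p]) := by
  have htm : t + m = y := by rw [hm, add_sub_cancel]
  rw [show 2 * t = 1 - t by linear_combination ht, prod_unitOrOne_one_sub_add h2 (by rwa [htm]),
    show -(m : ℤ_[p]) = t - y by rw [hm, neg_sub],
    show 1 - t + m = t + y by linear_combination hm - ht]
  linear_combination moritaGamma p t * (∏ i ∈ range m, unitOrOne (1 + i : ℤ_[p])) *
    gammaRatio_mul_sq h2 y t

theorem coe_eq_one_third (ht : 3 * t = 1) : (t : ℚ_[p]) = 1 / 3 := by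
  rw [eq_div_iff (by norm_num), mul_comm]
  exact_mod_cast congrArg (fun z : ℤ_[p] => (z : ℚ_[p])) ht

theorem coe_two_mul_eq_two_thirds (ht : 3 * t = 1) : ((2 * t : ℤ_[p]) : ℚ_[p]) = 2 / 3 := by
  rw [two_mul, coe_add, coe_eq_one_third ht]
  ring

theorem prime_dvd_two_mul_add_natCast_iff (ht : 3 * t = 1) (i : ℕ) :
    (p : ℤ_[p]) ∣ 2 * t + i ↔ p ∣ 3 * i + 2 := by
  have h3 : IsUnit (3 : ℤ_[p]) := IsUnit.of_mul_eq_one _ ht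
  have hcast : ((3 * i + 2 : ℕ) : ℤ_[p]) = 3 * (2 * t + i) := by
    push_cast
    linear_combination (-2) * ht
  rw [← h3.dvd_mul_left, ← hcast, ← norm_lt_one_iff_dvd, norm_natCast_lt_one_iff]

theorem isUnit_one_add_natCast {i : ℕ} (hi : i + 1 < p) : IsUnit (1 + i : ℤ_[p]) := by
  rw [add_comm, ← Nat.cast_succ, isUnit_natCast_iff]
  exact Nat.not_dvd_of_pos_of_lt i.succ_pos hi

theorem shiftedFactorial_coe (x : ℤ_[p]) (n : ℕ) :
    shiftedFactorial (x : ℚ_[p]) n = (∏ i ∈ range n, (x + i) : ℤ_[p]) := by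
  induction n with
  | zero => simp [shiftedFactorial]
  | succ n ih =>
    rw [shiftedFactorial, ascPochhammer_succ_eval, ← shiftedFactorial, ih, prod_range_succ]
    push_cast
    rfl

theorem coe_ringInverse {x : ℤ_[p]} (hx : IsUnit x) : ((x⁻¹ʳ : ℤ_[p]) : ℚ_[p]) = (x : ℚ_[p])⁻¹ := by
  apply eq_inv_of_mul_eq_one_right
  rw [← coe_mul, Ring.mul_inverse_cancel x hx, coe_one]

theorem prod_unitOrOne_div_shiftedFactorial_one (h2 : p ≠ 2) (ht : 3 * t = 1)
    (hy : (p : ℤ_[p]) ∣ y) (hm : (m : ℤ_[p]) = y - t) (hmp : m < p) :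
    ((∏ i ∈ range m, unitOrOne (2 * t + i) : ℤ_[p]) : ℚ_[p]) / shiftedFactorial (1 : ℚ_[p]) m =
      (-(moritaGamma p t ^ 3 * gammaRatio y t) : ℤ_[p]) := by
  have hunit {i : ℕ} (hi : i ∈ range m) : IsUnit (1 + i : ℤ_[p]) :=
    isUnit_one_add_natCast (by have := mem_range.1 hi; lia)
  rw [prod_unitOrOne_two_mul_add h2 ht hy hm, ← coe_one, shiftedFactorial_coe,
    prod_congr rfl fun i hi => unitOrOne_of_isUnit (hunit hi), coe_mul]
  refine mul_div_cancel_right₀ _ ?_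
  rw [Ne, PadicInt.coe_eq_zero, prod_eq_zero_iff]
  rintro ⟨i, hi, h0⟩
  exact (hunit hi).ne_zero h0

theorem sum_Icc_inv_sq_sub_inv_sq (ht : 3 * t = 1) (hnum : ∀ i < m, IsUnit (2 * t + i : ℤ_[p]))
    (hden : ∀ i < m, IsUnit (1 + i : ℤ_[p])) :
    ∑ j ∈ Icc 1 m, (1 / (3 * (j : ℚ_[p]) - 1) ^ 2 - 1 / (3 * (j : ℚ_[p])) ^ 2) =
      ((t ^ 2 * (sumInvSq m (2 * t) - sumInvSq m 1) : ℤ_[p]) : ℚ_[p]) := by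
  rw [sumInvSq, sumInvSq, ← sum_sub_distrib, mul_sum, PadicInt.coe_sum,
    ← Ico_add_one_right_eq_Icc, sum_Ico_eq_sum_range, Nat.add_sub_cancel]
  refine sum_congr rfl fun i hi => ?_
  have hi := mem_range.1 hi
  rw [coe_mul, coe_sub, coe_pow, coe_pow, coe_pow, coe_ringInverse (hnum i hi),
    coe_ringInverse (hden i hi), coe_add, coe_add, coe_two_mul_eq_two_thirds ht,
    coe_eq_one_third ht, coe_natCast, coe_one]
  have hshift : (3 : ℚ_[p]) * (1 + i : ℕ) - 1 = 3 * (2 / 3 + i) := by push_cast; ring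
  rw [hshift]
  simp only [Nat.cast_add, Nat.cast_one, one_div, mul_pow, _root_.mul_inv, inv_pow, mul_sub]

theorem padicModEq_coe {k : ℕ} {x y : ℤ_[p]} (h : (p : ℤ_[p]) ^ k ∣ x - y) :
    PadicModEq p k x y := by
  obtain ⟨c, hc⟩ := h
  exact ⟨c, by rw [← coe_sub, hc, coe_mul, coe_pow, coe_natCast]⟩

theorem padicModEq_four_of_eq_three_mul_add_one (hp : p = 3 * m + 1) (h2 : p ≠ 2)
    (ht : 3 * t = 1) :
    PadicModEq p 4
      (shiftedFactorial (2 / 3 : ℚ_[p]) m ^ 3 / shiftedFactorial (1 : ℚ_[p]) m ^ 3 *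
        (1 + (p : ℚ_[p]) ^ 2 *
          ∑ j ∈ Icc 1 m, (1 / (3 * (j : ℚ_[p]) - 1) ^ 2 - 1 / (3 * (j : ℚ_[p])) ^ 2)))
      (-(moritaGamma p t : ℚ_[p]) ^ 9) := by
  have h5 : 5 ≤ p := (Fact.out : p.Prime).five_le_of_ne_two_of_ne_three h2 (by lia)
  have hm : (m : ℤ_[p]) = p * t - t := by
    have hcast : (p : ℤ_[p]) = 3 * m + 1 := by exact_mod_cast congrArg (Nat.cast (R := ℤ_[p])) hp
    rw [hcast]
    linear_combination (-(m : ℤ_[p])) * ht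
  have hnum (i : ℕ) (hi : i < m) : IsUnit (2 * t + i : ℤ_[p]) := by
    rw [isUnit_iff_not_prime_dvd, prime_dvd_two_mul_add_natCast_iff ht]
    exact Nat.not_dvd_of_pos_of_lt (by lia) (by lia)
  have hratio := prod_unitOrOne_div_shiftedFactorial_one h2 ht (dvd_mul_right _ t) hm (by lia)
  rw [prod_congr rfl fun i hi => unitOrOne_of_isUnit (hnum i (mem_range.1 hi)),
    ← shiftedFactorial_coe, coe_two_mul_eq_two_thirds ht] at hratio
  rw [← div_pow, hratio, sum_Icc_inv_sq_sub_inv_sq ht hnum fun i hi =>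
    isUnit_one_add_natCast (by lia)]
  have hdvd := (prime_pow_four_dvd_gammaRatio_pow_three_mul_sub_one h5 ht (dvd_mul_right _ t)
    hm).mul_left (-moritaGamma p t ^ 9)
  rw [mul_sub_one] at hdvd
  convert padicModEq_coe hdvd using 1 <;> push_cast <;> ring

theorem prod_two_mul_add_eq_prime_mul {q : ℕ} (hp : p = 3 * q + 2) (ht : 3 * t = 1) :
    ∏ i ∈ range (2 * q + 1), (2 * t + i) =
      p * t * ∏ i ∈ range (2 * q + 1), unitOrOne (2 * t + i) := by
  have hq : 2 * t + q = p * t := by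
    have hcast : (p : ℤ_[p]) = 3 * q + 2 := by exact_mod_cast congrArg (Nat.cast (R := ℤ_[p])) hp
    rw [hcast]
    linear_combination (-(q : ℤ_[p])) * ht
  rw [← hq]
  refine prod_eq_mul_prod_unitOrOne (mem_range.2 (by lia)) ?_ fun i hi hne => ?_
  · rw [isUnit_iff_not_prime_dvd, not_not, hq]
    exact dvd_mul_right _ _
  · rw [isUnit_iff_not_prime_dvd, prime_dvd_two_mul_add_natCast_iff ht]
    have hi := mem_range.1 hi
    rintro ⟨c, hc⟩
    have hc2 : c < 2 := Nat.lt_of_mul_lt_mul_left (a := p) (by lia)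
    interval_cases c <;> lia

theorem padicModEq_five_of_eq_three_mul_add_two {q : ℕ} (hp : p = 3 * q + 2) (h2 : p ≠ 2)
    (ht : 3 * t = 1) :
    PadicModEq p 5
      (shiftedFactorial (2 / 3 : ℚ_[p]) (2 * q + 1) ^ 3 /
        shiftedFactorial (1 : ℚ_[p]) (2 * q + 1) ^ 3)
      (-((p : ℚ_[p]) ^ 3 / 27) * (moritaGamma p t : ℚ_[p]) ^ 9) := by
  have hcast : (p : ℤ_[p]) = 3 * q + 2 := by exact_mod_cast congrArg (Nat.cast (R := ℤ_[p])) hp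
  have hm : ((2 * q + 1 : ℕ) : ℤ_[p]) = p * (2 * t) - t := by
    rw [hcast]
    push_cast
    linear_combination (-(2 * q + 1 : ℤ_[p])) * ht
  have hy : (p : ℤ_[p]) ∣ p * (2 * t) := dvd_mul_right _ _
  rw [← div_pow, ← coe_two_mul_eq_two_thirds ht, shiftedFactorial_coe,
    prod_two_mul_add_eq_prime_mul hp ht, coe_mul, mul_div_assoc,
    prod_unitOrOne_div_shiftedFactorial_one h2 ht hy hm (by lia), ← coe_mul, ← coe_pow]
  have h27 : -((p : ℚ_[p]) ^ 3 / 27) * (moritaGamma p t : ℚ_[p]) ^ 9 =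
      (-(p * t) ^ 3 * moritaGamma p t ^ 9 : ℤ_[p]) := by
    push_cast
    rw [coe_eq_one_third ht]
    ring
  rw [h27]
  apply padicModEq_coe
  have hdvd := mul_dvd_mul_left ((p : ℤ_[p]) ^ 3) (prime_sq_dvd_gammaRatio_sub_one h2 hy t)
  rw [← pow_add] at hdvd
  generalize gammaRatio (p * (2 * t) : ℤ_[p]) t = D at hdvd ⊢
  convert hdvd.mul_left (-t ^ 3 * moritaGamma p t ^ 9 * (D ^ 2 + D + 1)) using 1
  ring

end OneThird

theorem proposition1p8 (p : ℕ) [Fact p.Prime] :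
    (p ≡ 1 [MOD 6] →
      PadicModEq p 4
        (shiftedFactorial (2 / 3 : ℚ_[p]) ((p - 1) / 3) ^ 3 /
            shiftedFactorial (1 : ℚ_[p]) ((p - 1) / 3) ^ 3 *
          (1 + (p : ℚ_[p]) ^ 2 *
            ∑ j ∈ Finset.Icc 1 ((p - 1) / 3),
              (1 / (3 * (j : ℚ_[p]) - 1) ^ 2 - 1 / (3 * (j : ℚ_[p])) ^ 2)))
        (-(moritaGamma p (oneThird p) : ℚ_[p]) ^ 9)) ∧
    (p ≡ 5 [MOD 6] →
      PadicModEq p 5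
        (shiftedFactorial (2 / 3 : ℚ_[p]) ((2 * p - 1) / 3) ^ 3 /
          shiftedFactorial (1 : ℚ_[p]) ((2 * p - 1) / 3) ^ 3)
        (-((p : ℚ_[p]) ^ 3 / 27) * (moritaGamma p (oneThird p) : ℚ_[p]) ^ 9)) := by
  refine ⟨fun (hmod : p % 6 = 1) => ?_, fun (hmod : p % 6 = 5) => ?_⟩
  · have hp : p = 3 * ((p - 1) / 3) + 1 := by lia
    exact padicModEq_four_of_eq_three_mul_add_one hp (by lia) (three_mul_oneThird p (by lia))
  · obtain ⟨q, hp⟩ : ∃ q, p = 3 * q + 2 := ⟨p / 3, by lia⟩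
    rw [show (2 * p - 1) / 3 = 2 * q + 1 by lia]
    exact padicModEq_five_of_eq_three_mul_add_two hp (by lia) (three_mul_oneThird p (by lia))
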